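/- All graphs are finite, simple, undirected and connected. A set $\mathcal T$ of spanning trees of a graph $G$ collectively $+2$-spans $G$ if for all vertices $u,v$ of $G$ there is a tree $T\in\mathcal T$ with $\mathrm{dist}_T(u,v)\le \mathrm{dist}_G(u,v)+2$. A graph is weakly chordal if neither it nor its complement contains an induced cycle on at least $5$ vertices; a graph is outerplanar if it can be drawn in the plane without crossings in such a way that all of its vertices lie on the boundary of the unbounded face. No constant number of spanning trees suffices to collectively $+2$-span all weakly chordal graphs, nor to collectively $+2$-span all outerplanar graphs. That is, for every $\mu\in\mathbb N$: 1. there is a weakly chordal graph $G$ such that no set of at most $\mu$ spanning trees of $G$ collectively $+2$-spans $G$; and 2. there is an outerplanar graph $G$ such that no set of at most $\mu$ spanning trees of $G$ collectively $+2$-spans $G$. -/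

import Mathlib

namespace CollTree

open SimpleGraph

/-! ### Collective additive tree spanners -/

/-- `T` is a spanning tree of `G`: a tree on the whole vertex set all of whose edges are
edges of `G`. -/
def IsSpanningTree {V : Type*} (G T : SimpleGraph V) : Prop :=
  T ≤ G ∧ T.IsTree

/-- The system `𝒯` consists of spanning trees of `G` and collectively `+c`-spans `G`: for any two
vertices some tree of the system has distance at most `c` plus the distance in `G`. -/
def CollectivelySpans {V : Type*} (G : SimpleGraph V) (𝒯 : Finset (SimpleGraph V)) (c : ℕ) :
    Prop :=
  (∀ T ∈ 𝒯, IsSpanningTree G T) ∧ ∀ u v : V, ∃ T ∈ 𝒯, T.dist u v ≤ G.dist u v + c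

/-- `G` admits a system of (at most) `μ` collective additive tree `c`-spanners. -/
def AdmitsTreeSpanners {V : Type*} (G : SimpleGraph V) (μ c : ℕ) : Prop :=
  ∃ 𝒯 : Finset (SimpleGraph V), 𝒯.card ≤ μ ∧ CollectivelySpans G 𝒯 c

/-! ### Weakly chordal graphs -/

/-- Neither `G` nor its complement contains an induced cycle on at least five vertices. -/
def IsWeaklyChordal {V : Type*} (G : SimpleGraph V) : Prop :=
  ∀ n : ℕ, 5 ≤ n →
    ¬ (cycleGraph n).IsIndContained G ∧ ¬ (cycleGraph n).IsIndContained Gᶜ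

/-! ### Outerplanar graphs -/

/-- A drawing of `G` in the plane without crossings: distinct vertices are distinct points, every
edge is a simple arc joining its two ends, no arc passes through a vertex other than its ends, and
two distinct arcs meet only in common ends. -/
structure PlaneDrawing {V : Type*} (G : SimpleGraph V) where
  pos : V → ℝ × ℝ
  pos_injective : Function.Injective pos
  arc : G.edgeSet → Set (ℝ × ℝ)
  arc_spec : ∀ (u v : V) (h : G.Adj u v),
    ∃ γ : Path (pos u) (pos v), Function.Injective γ ∧ Set.range γ = arc ⟨s(u, v), h⟩
  arc_vertex : ∀ (e : G.edgeSet) (v : V), pos v ∈ arc e → v ∈ e.1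
  arc_inter : ∀ e f : G.edgeSet, e ≠ f →
    ∀ x ∈ arc e ∩ arc f, ∃ v : V, v ∈ e.1 ∧ v ∈ f.1 ∧ x = pos v

/-- The set of points of the plane covered by a drawing. -/
def PlaneDrawing.support {V : Type*} {G : SimpleGraph V} (D : PlaneDrawing G) : Set (ℝ × ℝ) :=
  Set.range D.pos ∪ ⋃ e, D.arc e

/-- The faces of a drawing are the connected components of the complement of the drawing. -/
def PlaneDrawing.IsFace {V : Type*} {G : SimpleGraph V} (D : PlaneDrawing G)
    (F : Set (ℝ × ℝ)) : Prop :=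
  ∃ x ∈ D.supportᶜ, F = connectedComponentIn D.supportᶜ x

/-- `G` can be drawn in the plane without crossings in such a way that all vertices lie on the
boundary of the unbounded face. -/
def IsOuterplanar {V : Type*} (G : SimpleGraph V) : Prop :=
  ∃ (D : PlaneDrawing G) (F : Set (ℝ × ℝ)),
    D.IsFace F ∧ ¬ Bornology.IsBounded F ∧ ∀ v : V, D.pos v ∈ frontier F

end CollTree

/-! One family of graphs settles both claims. A house is a four-cycle `0 :: c`, `1 :: c`, `2 :: c`,
`3 :: c` with a roof triangle whose apex `c` is joined to `0 :: c` and `3 :: c`; every vertex is the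
apex of a further house, down to a bounded depth. With children formed by prepending a letter, `<:+`
means "is an ancestor of".

At an apex `w` a spanning tree either keeps all distances from `w` to its house (`Safe`) or loses at
least 1 on the way to some child. A safe tree must contain the path 1, 0, `w`, 3, 2, so it stretches
the floor edge from 1 to 4 (`Safe.dist_floor`). Since each vertex separates its proper descendants
from the rest, losses add up along descending paths (`dist_add_dist_le`, `Loses.trans`). By
induction on the number of trees, `exists_safe_or_loses` finds a house with apex `c` and a vertex
`y` below `2 :: c` such that every tree is safe at `c` or loses 3 between `2 :: c` and `y`. Either
way it loses 3 between `1 :: c` and `y`.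

Outerplanarity comes from a one-page book drawing in lexicographic order. Weak chordality comes from
`exists_degree_le_one_or_short_cycle`, applied to a deepest vertex of an induced subgraph. -/

namespace HouseTree

open SimpleGraph

/-! ### One-page book drawings -/

/-- The arc of a parabola above the interval from `s` to `t`. -/
noncomputable def parabola (s t : ℝ) : Path ((s, 0) : ℝ × ℝ) (t, 0) where
  toFun τ := (s + τ * (t - s), τ * (1 - τ) * (t - s) ^ 2)
  continuous_toFun := by fun_prop
  source' := by simp
  target' := by simp

lemma parabola_injective {s t : ℝ} (h : s ≠ t) : Function.Injective (parabola s t) := by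
  intro a b hab
  have h1 : s + a * (t - s) = s + b * (t - s) := congrArg Prod.fst hab
  have h2 : (a : ℝ) = b := mul_right_cancel₀ (sub_ne_zero.2 h.symm) (add_left_cancel h1)
  exact Subtype.ext h2

lemma range_parabola {s t : ℝ} (h : s < t) :
    Set.range (parabola s t) = {q | s ≤ q.1 ∧ q.1 ≤ t ∧ q.2 = (q.1 - s) * (t - q.1)} := by
  have h0 : 0 < t - s := sub_pos.2 h
  ext q
  constructor
  · rintro ⟨τ, rfl⟩
    have h1 := τ.2.1
    have h2 := τ.2.2
    refine ⟨?_, ?_, ?_⟩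
    · change s ≤ s + τ * (t - s)
      nlinarith
    · change s + τ * (t - s) ≤ t
      nlinarith
    · change (τ : ℝ) * (1 - τ) * (t - s) ^ 2 = (s + τ * (t - s) - s) * (t - (s + τ * (t - s)))
      ring
  · rintro ⟨h1, h2, h3⟩
    refine ⟨⟨(q.1 - s) / (t - s), by apply div_nonneg <;> linarith,
      by rw [div_le_one h0]; linarith⟩, ?_⟩
    refine Prod.ext ?_ ?_
    · change s + (q.1 - s) / (t - s) * (t - s) = q.1
      field_simp
      ring
    · change (q.1 - s) / (t - s) * (1 - (q.1 - s) / (t - s)) * (t - s) ^ 2 = q.2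
      rw [h3]
      field_simp
      ring

/-- The parabola over the interval between two reals, in either order. -/
def bridge (s t : ℝ) : Set (ℝ × ℝ) :=
  {q | min s t ≤ q.1 ∧ q.1 ≤ max s t ∧ q.2 = (q.1 - s) * (t - q.1)}

lemma bridge_comm (s t : ℝ) : bridge s t = bridge t s := by
  ext q
  simp only [bridge, Set.mem_ofPred_eq, min_comm s t, max_comm s t]
  rw [show (q.1 - s) * (t - q.1) = (q.1 - t) * (s - q.1) by ring]

lemma bridge_of_lt {s t : ℝ} (h : s < t) :
    bridge s t = {q | s ≤ q.1 ∧ q.1 ≤ t ∧ q.2 = (q.1 - s) * (t - q.1)} := by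
  simp only [bridge, min_eq_left h.le, max_eq_right h.le]

lemma exists_path_range_eq_bridge {s t : ℝ} (h : s ≠ t) :
    ∃ γ : Path ((s, 0) : ℝ × ℝ) (t, 0), Function.Injective γ ∧ Set.range γ = bridge s t := by
  rcases lt_or_gt_of_ne h with h' | h'
  · exact ⟨parabola s t, parabola_injective h, by rw [range_parabola h', bridge_of_lt h']⟩
  · refine ⟨(parabola t s).symm, ?_, ?_⟩
    · exact (parabola_injective h.symm).comp unitInterval.symm_bijective.injective
    · rw [Path.symm_range, range_parabola h', bridge_comm, bridge_of_lt h']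

lemma bridge_snd_nonneg {s t : ℝ} {q : ℝ × ℝ} (h : q ∈ bridge s t) : 0 ≤ q.2 := by
  wlog hst : s ≤ t generalizing s t
  · exact this (bridge_comm s t ▸ h) (le_of_not_ge hst)
  obtain ⟨h1, h2, h3⟩ := h
  rw [min_eq_left hst] at h1
  rw [max_eq_right hst] at h2
  rw [h3]
  exact mul_nonneg (by linarith) (by linarith)

lemma eq_or_eq_of_mem_bridge {s t x : ℝ} (h : ((x, 0) : ℝ × ℝ) ∈ bridge s t) : x = s ∨ x = t := by
  rcases mul_eq_zero.1 h.2.2.symm with h | h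
  · exact Or.inl (sub_eq_zero.1 h)
  · exact Or.inr (sub_eq_zero.1 h).symm

/-- Two parabolas over intervals that do not cross meet only in common ends. -/
lemma bridge_inter {s t s' t' : ℝ} (h : s < t) (h' : s' < t') (hne : s = s' → t ≠ t')
    (h₁ : ¬ (s < s' ∧ s' < t ∧ t < t')) (h₂ : ¬ (s' < s ∧ s < t' ∧ t' < t))
    {q : ℝ × ℝ} (hq : q ∈ bridge s t) (hq' : q ∈ bridge s' t') :
    q.2 = 0 ∧ (q.1 = s ∨ q.1 = t) ∧ (q.1 = s' ∨ q.1 = t') := by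
  rw [bridge_of_lt h] at hq
  rw [bridge_of_lt h'] at hq'
  obtain ⟨x, y⟩ := q
  obtain ⟨a1, a2, a3⟩ := hq
  obtain ⟨b1, b2, b3⟩ := hq'
  dsimp only at *
  suffices H : (x = s ∨ x = t) ∧ (x = s' ∨ x = t') by
    refine ⟨?_, H⟩
    rcases H.1 with rfl | rfl <;> simp [a3]
  rcases le_or_gt t s' with c | c
  · have hx : x = t := by linarith
    have hx' : x = s' := by linarith
    exact ⟨.inr hx, .inl hx'⟩
  rcases le_or_gt t' s with c' | c'
  · have hx : x = s := by linarith
    have hx' : x = t' := by linarith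
    exact ⟨.inl hx, .inr hx'⟩
  -- Nested intervals: the outer parabola minus the inner one is `(a' - a) * (b - x) + (x - a') * (b
  -- - b')`. Both summands are nonnegative, so both vanish at a meeting point.
  have key : ∀ {a b a' b' : ℝ}, a ≤ a' → b' ≤ b → (a = a' → b ≠ b') → a' ≤ x → x ≤ b' →
      (x - a) * (b - x) = (x - a') * (b' - x) → (x = a ∨ x = b) ∧ (x = a' ∨ x = b') := by
    intro a b a' b' ha hb hab hx1 hx2 he
    have e1 : (a' - a) * (b - x) + (x - a') * (b - b') = 0 := by linarith
    have p1 : 0 ≤ (a' - a) * (b - x) := mul_nonneg (by linarith) (by linarith)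
    have p2 : 0 ≤ (x - a') * (b - b') := mul_nonneg (by linarith) (by linarith)
    have z1 : (a' - a) * (b - x) = 0 := by linarith
    have z2 : (x - a') * (b - b') = 0 := by linarith
    rcases mul_eq_zero.1 z1 with z1 | z1 <;> rcases mul_eq_zero.1 z2 with z2 | z2
    · exact ⟨.inl (by linarith), .inl (by linarith)⟩
    · exact absurd (sub_eq_zero.1 z2) (hab (sub_eq_zero.1 z1).symm)
    · exact ⟨.inr (by linarith), .inl (by linarith)⟩
    · exact ⟨.inr (by linarith), .inr (by linarith)⟩
  rcases lt_trichotomy s s' with d | d | d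
  · have d' : t' ≤ t := le_of_not_gt fun e => h₁ ⟨d, c, e⟩
    exact key d.le d' (fun e => absurd e d.ne) b1 b2 (a3 ▸ b3)
  · rcases le_total t' t with d' | d'
    · exact key d.le d' hne b1 b2 (a3 ▸ b3)
    · exact (key d.ge d' (fun e e' => hne e.symm e'.symm) a1 a2 (b3 ▸ a3)).symm
  · have d' : t ≤ t' := le_of_not_gt fun e => h₂ ⟨d, c', e⟩
    exact (key d.le d' (fun e => absurd e d.ne) a1 a2 (b3 ▸ a3)).symm

/-- The bridge over the ends of an edge. -/
def edgeBridge {V : Type*} (pos : V → ℝ) : Sym2 V → Set (ℝ × ℝ) :=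
  Sym2.lift ⟨fun u v => bridge (pos u) (pos v), fun _ _ => bridge_comm _ _⟩

lemma exists_lt_edgeBridge {V : Type*} {G : SimpleGraph V} {pos : V → ℝ}
    (hpos : Function.Injective pos) (e : G.edgeSet) :
    ∃ u v, e.1 = s(u, v) ∧ G.Adj u v ∧ pos u < pos v ∧
      edgeBridge pos e.1 = bridge (pos u) (pos v) := by
  obtain ⟨e, he⟩ := e
  induction e with
  | _ u v =>
    rcases lt_or_gt_of_ne (hpos.ne (G.ne_of_adj he)) with h | h
    · exact ⟨u, v, rfl, he, h, rfl⟩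
    · exact ⟨v, u, Sym2.eq_swap, G.adj_symm he, h, bridge_comm _ _⟩

/-- The one-page book drawing of a graph whose vertices are placed on a line so that no two edges
cross. -/
def bookDrawing {V : Type*} (G : SimpleGraph V) (pos : V → ℝ) (hpos : Function.Injective pos)
    (hcross : ∀ a b c d, G.Adj a b → G.Adj c d → ¬ (pos a < pos c ∧ pos c < pos b ∧ pos b < pos d)) :
    CollTree.PlaneDrawing G where
  pos v := (pos v, 0)
  pos_injective u v h := hpos (congrArg Prod.fst h)
  arc e := edgeBridge pos e.1
  arc_spec u v h := exists_path_range_eq_bridge (hpos.ne (G.ne_of_adj h))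
  arc_vertex e v hv := by
    obtain ⟨a, b, hab, -, -, h⟩ := exists_lt_edgeBridge hpos e
    rw [h] at hv
    rw [hab, Sym2.mem_iff]
    exact (eq_or_eq_of_mem_bridge hv).imp (fun h => hpos h) fun h => hpos h
  arc_inter e f hef q hq := by
    obtain ⟨a, b, hab, hadj, hlt, h⟩ := exists_lt_edgeBridge hpos e
    obtain ⟨c, d, hcd, hadj', hlt', h'⟩ := exists_lt_edgeBridge hpos f
    rw [h, h'] at hq
    obtain ⟨h0, h1, h2⟩ := bridge_inter hlt hlt'
      (fun e1 e2 => hef (Subtype.ext (by rw [hab, hcd, hpos e1, hpos e2])))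
      (hcross a b c d hadj hadj') (hcross c d a b hadj' hadj) hq.1 hq.2
    have key : ∃ v, (v = a ∨ v = b) ∧ q.1 = pos v := by
      rcases h1 with h1 | h1
      exacts [⟨a, .inl rfl, h1⟩, ⟨b, .inr rfl, h1⟩]
    obtain ⟨v, hv, hqv⟩ := key
    refine ⟨v, by rw [hab, Sym2.mem_iff]; exact hv, ?_, Prod.ext hqv h0⟩
    rw [hcd, Sym2.mem_iff]
    rw [hqv] at h2
    exact h2.imp (fun h => hpos h) fun h => hpos h

/-- A graph with a one-page book embedding is outerplanar. -/
theorem isOuterplanar_of_noncrossing {V : Type*} {G : SimpleGraph V} (pos : V → ℝ)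
    (hpos : Function.Injective pos)
    (hcross : ∀ a b c d, G.Adj a b → G.Adj c d →
      ¬ (pos a < pos c ∧ pos c < pos b ∧ pos b < pos d)) :
    CollTree.IsOuterplanar G := by
  set D := bookDrawing G pos hpos hcross with hD
  have hsupp : ∀ q ∈ D.support, 0 ≤ q.2 := by
    rintro q (⟨v, rfl⟩ | hq)
    · exact le_rfl
    · obtain ⟨e, he⟩ := Set.mem_iUnion.1 hq
      obtain ⟨a, b, -, -, -, h⟩ := exists_lt_edgeBridge hpos e
      exact bridge_snd_nonneg (h ▸ he : q ∈ bridge (pos a) (pos b))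
  -- All arcs lie in the closed upper half-plane, so the open lower one is contained in a single
  -- face, which is unbounded and reaches every vertex from below.
  set L : Set (ℝ × ℝ) := {q | q.2 < 0} with hL
  have hLsupp : L ⊆ D.supportᶜ := fun q hq hq' => absurd (hsupp q hq') (not_le.2 hq)
  have hLconn : IsPreconnected L := by
    have : Convex ℝ L := convex_halfSpace_lt (f := Prod.snd) ⟨fun _ _ => rfl, fun _ _ => rfl⟩ 0
    exact this.isPreconnected
  have hx : ((0, -1) : ℝ × ℝ) ∈ L := by simp [hL]
  have hLF : L ⊆ connectedComponentIn D.supportᶜ (0, -1) :=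
    hLconn.subset_connectedComponentIn hx hLsupp
  refine ⟨D, _, ⟨(0, -1), hLsupp hx, rfl⟩, ?_, ?_⟩
  · intro hb
    obtain ⟨R, hR⟩ := (hb.subset hLF).exists_norm_le
    have h1 : ((0, -(|R| + 1)) : ℝ × ℝ) ∈ L := by
      have := abs_nonneg R
      simp only [hL, Set.mem_ofPred_eq]
      linarith
    have h2 := (norm_snd_le _).trans (hR _ h1)
    have h3 := le_abs_self R
    simp only [norm_neg, Real.norm_eq_abs] at h2
    have h4 := le_abs_self (|R| + 1)
    linarith
  · intro v
    refine ⟨closure_mono hLF ?_, fun h => ?_⟩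
    · refine mem_closure_of_tendsto (f := fun n : ℕ => ((pos v, -(1 / ((n : ℝ) + 1))) : ℝ × ℝ))
        (b := Filter.atTop) ?_ (Filter.Eventually.of_forall fun n => ?_)
      · refine Filter.Tendsto.prodMk_nhds tendsto_const_nhds ?_
        simpa using (tendsto_one_div_add_atTop_nhds_zero_nat (𝕜 := ℝ)).neg
      · simp only [hL, Set.mem_ofPred_eq, neg_lt_zero]
        positivity
    · exact connectedComponentIn_subset _ _ (interior_subset h) (Or.inl ⟨v, rfl⟩)

/-! ### Trees of houses -/

/-- A vertex `c` is the apex of a house whose walls form the four-cycle `0 :: c`, `1 :: c`,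
`2 :: c`, `3 :: c` and in which `c` is joined to `0 :: c` and `3 :: c`. -/
inductive HouseEdge : List (Fin 4) → List (Fin 4) → Prop
  | left (c : List (Fin 4)) : HouseEdge c (0 :: c)
  | right (c : List (Fin 4)) : HouseEdge c (3 :: c)
  | wall (c : List (Fin 4)) (i : Fin 4) : HouseEdge (i :: c) ((i + 1) :: c)

lemma HouseEdge.ne {x y : List (Fin 4)} (h : HouseEdge x y) : x ≠ y := by
  cases h <;> simp

/-- The infinite tree of houses: every vertex is the apex of a house. -/
def houseTree : SimpleGraph (List (Fin 4)) where
  Adj x y := HouseEdge x y ∨ HouseEdge y x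
  symm := ⟨fun _ _ h => h.symm⟩
  loopless := ⟨fun _ h => h.elim (fun h => h.ne rfl) fun h => h.ne rfl⟩

lemma houseTree_adj_left (c : List (Fin 4)) : houseTree.Adj c (0 :: c) := .inl (.left c)

lemma houseTree_adj_right (c : List (Fin 4)) : houseTree.Adj c (3 :: c) := .inl (.right c)

lemma houseTree_adj_wall (c : List (Fin 4)) (i : Fin 4) : houseTree.Adj (i :: c) ((i + 1) :: c) :=
  .inl (.wall c i)

lemma houseTree_adj_cons {i : Fin 4} {c y : List (Fin 4)} (h : houseTree.Adj (i :: c) y) :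
    (y = c ∧ (i = 0 ∨ i = 3)) ∨ y = (i + 1) :: c ∨ y = (i - 1) :: c ∨
      (∃ j, y = j :: i :: c) := by
  rcases h with h | h
  · cases h with
    | left => exact .inr (.inr (.inr ⟨_, rfl⟩))
    | right => exact .inr (.inr (.inr ⟨_, rfl⟩))
    | wall => exact .inr (.inl rfl)
  · cases h with
    | left => exact .inl ⟨rfl, .inl rfl⟩
    | right => exact .inl ⟨rfl, .inr rfl⟩
    | wall _ j => exact .inr (.inr (.inl (by simp)))

/-- The part of the tree of houses of depth at most `N`. -/
abbrev Vertex (N : ℕ) : Type := {l : List (Fin 4) // l.length ≤ N}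

instance (N : ℕ) : Finite (Vertex N) := (List.finite_length_le (Fin 4) N).to_subtype

/-- The tree of houses of depth `N`. -/
def boundedHouseTree (N : ℕ) : SimpleGraph (Vertex N) := houseTree.comap Subtype.val

lemma boundedHouseTree_connected (N : ℕ) : (boundedHouseTree N).Connected := by
  let r : Vertex N := ⟨[], by simp⟩
  have key : ∀ (c : List (Fin 4)) (h : c.length ≤ N), (boundedHouseTree N).Reachable r ⟨c, h⟩ := by
    intro c
    induction c with
    | nil => intro h; exact .rfl
    | cons i c ih =>
      intro h
      have h' : ∀ j : Fin 4, (j :: c).length ≤ N := fun _ => h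
      have hc : c.length ≤ N := by simp at h; omega
      have e0 : (boundedHouseTree N).Adj ⟨c, hc⟩ ⟨0 :: c, h' 0⟩ := houseTree_adj_left c
      have e3 : (boundedHouseTree N).Adj ⟨c, hc⟩ ⟨3 :: c, h' 3⟩ := houseTree_adj_right c
      have e1 : (boundedHouseTree N).Adj ⟨0 :: c, h' 0⟩ ⟨1 :: c, h' 1⟩ := houseTree_adj_wall c 0
      have e2 : (boundedHouseTree N).Adj ⟨1 :: c, h' 1⟩ ⟨2 :: c, h' 2⟩ := houseTree_adj_wall c 1
      have r0 := (ih hc).trans e0.reachable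
      fin_cases i
      exacts [r0, r0.trans e1.reachable, (r0.trans e1.reachable).trans e2.reachable,
        (ih hc).trans e3.reachable]
  have : Nonempty (Vertex N) := ⟨r⟩
  exact ⟨fun x y => (key x.1 x.2).symm.trans (key y.1 y.2)⟩

/-! ### Outerplanarity -/

/-- The edges of the tree of houses, with the vertices read from the root. -/
inductive RootEdge : List (Fin 4) → List (Fin 4) → Prop
  | left : RootEdge [] [0]
  | right : RootEdge [] [3]
  | wall (i : Fin 4) : RootEdge [i] [i + 1]
  | cons (i : Fin 4) {x y : List (Fin 4)} : RootEdge x y → RootEdge (i :: x) (i :: y)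

lemma RootEdge.append (c : List (Fin 4)) {x y : List (Fin 4)} (h : RootEdge x y) :
    RootEdge (c ++ x) (c ++ y) := by
  induction c with
  | nil => exact h
  | cons i c ih => exact .cons i ih

/-- Reversal turns ancestors into prefixes, so that every subtree is an interval of the
lexicographic order. -/
lemma HouseEdge.rootEdge_reverse {x y : List (Fin 4)} (h : HouseEdge x y) :
    RootEdge x.reverse y.reverse := by
  cases h with
  | left => simpa using RootEdge.left.append x.reverse
  | right => simpa using RootEdge.right.append x.reverse
  | wall c i => simpa using (RootEdge.wall i).append c.reverse

lemma lt_of_cons_lt_singleton {i j : Fin 4} {x : List (Fin 4)} (h : i :: x < [j]) : i < j := by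
  rcases List.cons_lt_cons_iff.1 h with h | ⟨-, h⟩
  · exact h
  · simp at h

/-- The symmetric closure of `RootEdge`. -/
def RootAdj (x y : List (Fin 4)) : Prop := RootEdge x y ∨ RootEdge y x

lemma RootAdj.cases {x y : List (Fin 4)} (h : RootAdj x y) :
    (x = [] ∧ (y = [0] ∨ y = [3])) ∨ (y = [] ∧ (x = [0] ∨ x = [3])) ∨
    (∃ i j, x = [i] ∧ y = [j] ∧ (j = i + 1 ∨ i = j + 1)) ∨
    ∃ i x' y', x = i :: x' ∧ y = i :: y' ∧ RootAdj x' y' := by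
  rcases h with h | h <;> cases h
  all_goals simp_all [RootAdj]

/-- Common first letters are stripped by induction. What remains is a roof edge at the root, a pair
of walls of one four-cycle (checked by `decide`), or an edge inside one child's subtree, whose
interval contains no end of a wall strictly inside it. -/
lemma RootAdj.not_cross {a b c d : List (Fin 4)} (h : RootAdj a b) (h' : RootAdj c d) :
    ¬ (a < c ∧ c < b ∧ b < d) := by
  rintro ⟨h1, h2, h3⟩
  induction a generalizing b c d with
  | nil =>
    rcases h.cases with ⟨-, rfl | rfl⟩ | ⟨rfl, h | h⟩ | ⟨i, j, h, -⟩ | ⟨i, x, y, h, -⟩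
    any_goals simp at h
    · cases c with
      | nil => simp at h1
      | cons k c => exact absurd (lt_of_cons_lt_singleton h2) (by simp)
    · cases c with
      | nil => simp at h1
      | cons k c =>
        have hk := lt_of_cons_lt_singleton h2
        rcases h'.cases with ⟨h, -⟩ | ⟨rfl, -⟩ | ⟨i, j, h, rfl, -⟩ | ⟨i, x, y, h, rfl, -⟩
        · simp at h
        · simp at h3
        · simp only [List.cons.injEq] at h
          obtain ⟨rfl, rfl⟩ := h
          rcases List.cons_lt_cons_iff.1 h3 with h3 | ⟨-, h3⟩
          · omega
          · simp at h3
        · simp only [List.cons.injEq] at h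
          obtain ⟨rfl, rfl⟩ := h
          rcases List.cons_lt_cons_iff.1 h3 with h3 | ⟨h3, -⟩ <;> omega
  | cons i a ih =>
    have hc : c ≠ [] := by rintro rfl; simp at h1
    have hb : b ≠ [] := by rintro rfl; simp at h2
    have hd : d ≠ [] := by rintro rfl; simp at h3
    rcases h'.cases with ⟨h, -⟩ | ⟨h, -⟩ | ⟨k, l, rfl, rfl, hkl⟩ | ⟨k, c, d, rfl, rfl, hcd⟩
    · exact hc h
    · exact hd h
    · rcases h.cases with ⟨h, -⟩ | ⟨h, -⟩ | ⟨i', j, hi, rfl, hij⟩ | ⟨i', a', b, hi, rfl, hab⟩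
      · simp at h
      · exact hb h
      · obtain ⟨rfl, rfl⟩ := List.cons_eq_cons.1 hi
        simp only [List.cons_lt_cons_iff, List.not_lt_nil, and_false, or_false] at h1 h2 h3
        clear h h' ih hc hb hd hi
        revert i k j l
        decide
      · obtain ⟨rfl, rfl⟩ := List.cons_eq_cons.1 hi
        simp only [List.cons_lt_cons_iff, List.not_lt_nil, and_false, or_false] at h1 h2 h3
        rcases h2 with h2 | ⟨h2, -⟩ <;> omega
    · rcases h.cases with ⟨h, -⟩ | ⟨h, -⟩ | ⟨i', j, hi, rfl, hij⟩ | ⟨i', a', b, hi, rfl, hab⟩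
      · simp at h
      · exact hb h
      · obtain ⟨rfl, rfl⟩ := List.cons_eq_cons.1 hi
        simp only [List.cons_lt_cons_iff, List.not_lt_nil, and_false, or_false] at h1 h2 h3
        rcases h3 with h3 | ⟨h3, -⟩ <;> omega
      · obtain ⟨rfl, rfl⟩ := List.cons_eq_cons.1 hi
        simp only [List.cons_lt_cons_iff] at h1 h2 h3
        have hik : i = k := by omega
        subst hik
        simp only [lt_irrefl, false_or, true_and] at h1 h2 h3
        exact ih hab hcd h1 h2 h3

theorem boundedHouseTree_isOuterplanar (N : ℕ) : CollTree.IsOuterplanar (boundedHouseTree N) := by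
  -- Only the order of the points on the line matters, and a countable linear order embeds into `ℝ`.
  obtain ⟨f⟩ := Order.embedding_from_countable_to_dense (List (Fin 4)) ℝ
  have key : ∀ {x y : Vertex N}, (boundedHouseTree N).Adj x y → RootAdj x.1.reverse y.1.reverse :=
    fun h => h.imp HouseEdge.rootEdge_reverse HouseEdge.rootEdge_reverse
  refine isOuterplanar_of_noncrossing (fun x => f x.1.reverse)
    (fun x y h => Subtype.ext (List.reverse_injective (f.injective h))) fun a b c d h h' hcr => ?_
  simp only [OrderEmbedding.lt_iff_lt] at hcr
  exact (key h).not_cross (key h') hcr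

/-! ### Weak chordality -/

/-- A finite induced subgraph of the tree of houses has a vertex of degree at most one, or a vertex
of degree two that lies on a triangle or a four-cycle. -/
lemma exists_degree_le_one_or_short_cycle {α : Type*} [Finite α] [Nonempty α] {H : SimpleGraph α}
    (f : H ↪g houseTree) :
    ∃ a b c, (∀ d, H.Adj a d → d = b ∨ d = c) ∧
      (b = c ∨ (H.Adj a b ∧ H.Adj a c ∧
        (H.Adj b c ∨ ∃ d, d ≠ a ∧ b ≠ c ∧ H.Adj b d ∧ H.Adj c d))) := by
  have single : ∀ a y, (∀ d, H.Adj a d → f d = y) →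
      ∃ a b c, (∀ d, H.Adj a d → d = b ∨ d = c) ∧
      (b = c ∨ (H.Adj a b ∧ H.Adj a c ∧
        (H.Adj b c ∨ ∃ d, d ≠ a ∧ b ≠ c ∧ H.Adj b d ∧ H.Adj c d))) := by
    intro a y h
    by_cases hd : ∃ d, H.Adj a d
    · obtain ⟨d, hd⟩ := hd
      exact ⟨a, d, d, fun e he => .inl (f.injective ((h e he).trans (h d hd).symm)), .inl rfl⟩
    · exact ⟨a, a, a, fun e he => absurd ⟨e, he⟩ hd, .inl rfl⟩
  -- A deepest vertex has no children in the subgraph, so its neighbours lie in the house of its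
  -- parent `w`. The cases ask which vertices of that house are present: a missing one leaves some
  -- vertex with at most one neighbour, otherwise a short cycle closes up.
  obtain ⟨a, ha⟩ := Finite.exists_max fun a => (f a).length
  cases hx : f a with
  | nil =>
    refine single a [] fun d _ => ?_
    have := ha d
    simpa [hx] using this
  | cons i w =>
    have hlen : ∀ d, (f d).length ≤ w.length + 1 := by simpa [hx] using ha
    have nb : ∀ {b d : α} {j : Fin 4}, f b = j :: w → H.Adj b d →
        (f d = w ∧ (j = 0 ∨ j = 3)) ∨ f d = (j + 1) :: w ∨ f d = (j - 1) :: w := by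
      intro b d j hb hbd
      have h := f.map_adj_iff.2 hbd
      rw [hb] at h
      rcases houseTree_adj_cons h with h | h | h | ⟨k, h⟩
      · exact .inl h
      · exact .inr (.inl h)
      · exact .inr (.inr h)
      · have := hlen d
        simp [h] at this
    have adj : ∀ {b d : α}, houseTree.Adj (f b) (f d) → H.Adj b d := fun h => f.map_adj_iff.1 h
    by_cases h1 : ∃ b, f b = 1 :: w
    · obtain ⟨b1, h1⟩ := h1
      have n1 : ∀ d, H.Adj b1 d → f d = 2 :: w ∨ f d = 0 :: w := by
        intro d hd
        simpa using nb h1 hd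
      by_cases h0 : ∃ b, f b = 0 :: w
      swap
      · exact single b1 (2 :: w) fun d hd => (n1 d hd).resolve_right fun h => h0 ⟨d, h⟩
      by_cases h2 : ∃ b, f b = 2 :: w
      swap
      · exact single b1 (0 :: w) fun d hd => (n1 d hd).resolve_left fun h => h2 ⟨d, h⟩
      obtain ⟨b0, h0⟩ := h0
      obtain ⟨b2, h2⟩ := h2
      have n2 : ∀ d, H.Adj b2 d → f d = 3 :: w ∨ f d = 1 :: w := by
        intro d hd
        simpa using nb h2 hd
      by_cases h3 : ∃ b, f b = 3 :: w
      swap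
      · exact single b2 (1 :: w) fun d hd => (n2 d hd).resolve_left fun h => h3 ⟨d, h⟩
      obtain ⟨b3, h3⟩ := h3
      refine ⟨b1, b0, b2, fun d hd => ?_, .inr ⟨?_, ?_, .inr ⟨b3, ?_, ?_, ?_, ?_⟩⟩⟩
      · rcases n1 d hd with h | h
        · exact .inr (f.injective (h.trans h2.symm))
        · exact .inl (f.injective (h.trans h0.symm))
      · exact adj (by rw [h1, h0]; exact (houseTree_adj_wall w 0).symm)
      · exact adj (by rw [h1, h2]; exact houseTree_adj_wall w 1)
      · rintro rfl
        simp [h1] at h3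
      · rintro rfl
        simp [h0] at h2
      · exact adj (by rw [h0, h3]; exact (houseTree_adj_wall w 3).symm)
      · exact adj (by rw [h2, h3]; exact houseTree_adj_wall w 2)
    by_cases h2 : ∃ b, f b = 2 :: w
    · obtain ⟨b2, h2⟩ := h2
      refine single b2 (3 :: w) fun d hd => ?_
      have : f d = 3 :: w ∨ f d = 1 :: w := by simpa using nb h2 hd
      exact this.resolve_right fun h => h1 ⟨d, h⟩
    -- With both floor vertices absent, only the roof triangle can remain.
    have n0 : ∀ {b0 d}, f b0 = 0 :: w → H.Adj b0 d → f d = w ∨ f d = 3 :: w := by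
      intro b0 d h0 hd
      rcases nb h0 hd with ⟨h, -⟩ | h | h
      · exact .inl h
      · exact absurd ⟨d, h⟩ h1
      · exact .inr h
    have n3 : ∀ {b3 d}, f b3 = 3 :: w → H.Adj b3 d → f d = w ∨ f d = 0 :: w := by
      intro b3 d h3 hd
      rcases nb h3 hd with ⟨h, -⟩ | h | h
      · exact .inl h
      · exact .inr h
      · exact absurd ⟨d, h⟩ h2
    by_cases h0 : ∃ b, f b = 0 :: w
    swap
    · have h3 : f a = 3 :: w := by
        fin_cases i
        exacts [absurd ⟨a, hx⟩ h0, absurd ⟨a, hx⟩ h1, absurd ⟨a, hx⟩ h2, hx]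
      exact single a w fun d hd => (n3 h3 hd).resolve_right fun h => h0 ⟨d, h⟩
    obtain ⟨b0, h0⟩ := h0
    by_cases hw : ∃ b, f b = w
    swap
    · exact single b0 (3 :: w) fun d hd => (n0 h0 hd).resolve_left fun h => hw ⟨d, h⟩
    by_cases h3 : ∃ b, f b = 3 :: w
    swap
    · exact single b0 w fun d hd => (n0 h0 hd).resolve_right fun h => h3 ⟨d, h⟩
    obtain ⟨b, hb⟩ := hw
    obtain ⟨b3, h3⟩ := h3
    refine ⟨b0, b, b3, fun d hd => ?_, .inr ⟨?_, ?_, .inl ?_⟩⟩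
    · exact (n0 h0 hd).imp (fun h => f.injective (h.trans hb.symm))
        fun h => f.injective (h.trans h3.symm)
    · exact adj (by rw [h0, hb]; exact (houseTree_adj_left w).symm)
    · exact adj (by rw [h0, h3]; exact (houseTree_adj_wall w 3).symm)
    · exact adj (by rw [hb, h3]; exact houseTree_adj_right w)

lemma cycleGraph_adj_iff {n : ℕ} (hn : 2 ≤ n) {u v : Fin n} :
    (cycleGraph n).Adj u v ↔ u.val + 1 = v.val ∨ v.val + 1 = u.val ∨
      (u.val = 0 ∧ v.val + 1 = n) ∨ (v.val = 0 ∧ u.val + 1 = n) := by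
  rw [cycleGraph_adj']
  have key : ∀ a b : Fin n, (a - b).val = 1 ↔
      b.val + 1 = a.val ∨ (a.val = 0 ∧ b.val + 1 = n) := by
    intro a b
    have ha := a.2
    have hb := b.2
    rcases le_or_gt b a with h | h
    · rw [Fin.sub_val_of_le h]
      have : b.val ≤ a.val := h
      omega
    · rw [Fin.coe_sub_iff_lt.2 h]
      have : a.val < b.val := h
      omega
  rw [key, key]
  tauto

/-- A cycle on at least five vertices is 2-regular without triangles or four-cycles. Its complement
is regular of degree `n - 3`, which the degree bound limits to 2; this leaves `n = 5`, where the
complement is again a five-cycle. -/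
theorem boundedHouseTree_isWeaklyChordal (N : ℕ) :
    CollTree.IsWeaklyChordal (boundedHouseTree N) := by
  intro n hn
  let ι : boundedHouseTree N ↪g houseTree := Embedding.comap ⟨Subtype.val, Subtype.val_injective⟩ _
  have : Nonempty (Fin n) := ⟨⟨0, by omega⟩⟩
  have hadj := fun {u v : Fin n} => cycleGraph_adj_iff (u := u) (v := v) (by omega : 2 ≤ n)
  constructor
  · rintro ⟨f⟩
    obtain ⟨a, b, c, hdeg, h⟩ := exists_degree_le_one_or_short_cycle (ι.comp f)
    rcases h with rfl | ⟨hab, hac, h⟩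
    · have hd : (cycleGraph n).degree a = 2 := by
        obtain ⟨m, rfl⟩ := Nat.exists_eq_add_of_le' (show 3 ≤ n by omega)
        exact cycleGraph_degree_three_le
      have : (cycleGraph n).neighborFinset a ⊆ {b} := fun d hd => by
        simpa using hdeg d (by simpa using hd)
      have := Finset.card_le_card this
      rw [card_neighborFinset_eq_degree, hd] at this
      simp at this
    · rw [hadj] at hab hac
      rcases h with hbc | ⟨d, hda, hbc, hbd, hcd⟩
      · rw [hadj] at hbc
        omega
      · rw [hadj] at hbd hcd
        rw [Ne, Fin.ext_iff] at hda hbc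
        omega
  · rintro ⟨f⟩
    obtain ⟨a, b, c, hdeg, h⟩ := exists_degree_le_one_or_short_cycle (H := (cycleGraph n)ᶜ)
      (ι.comp (by simpa using Embedding.complEquiv f))
    have hd : (cycleGraph n)ᶜ.degree a = n - 3 := by
      have hd : (cycleGraph n).degree a = 2 := by
        obtain ⟨m, rfl⟩ := Nat.exists_eq_add_of_le' (show 3 ≤ n by omega)
        exact cycleGraph_degree_three_le
      rw [degree_compl, hd, Fintype.card_fin]
      omega
    have hsub : (cycleGraph n)ᶜ.neighborFinset a ⊆ {b, c} := fun d hd => by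
      simpa using hdeg d (by simpa using hd)
    have hle := Finset.card_le_card hsub
    rw [card_neighborFinset_eq_degree, hd] at hle
    have hle2 := Finset.card_le_two (a := b) (b := c)
    have h5 : n = 5 := by omega
    subst h5
    clear hdeg hsub hd hadj f this hn
    rcases h with rfl | h
    · simp at hle
    · clear hle hle2
      revert a b c
      decide

/-! ### Distances in spanning trees of the tree of houses -/

/-- The cut-vertex property: an edge leaving the set of proper descendants of `w` can only end at
`w`. -/
lemma houseTree_eq_of_adj {u z w : List (Fin 4)} (h : houseTree.Adj z u) (hz : w <:+ z)
    (hzw : z ≠ w) (hu : w <:+ u → u = w) : u = w := by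
  cases z with
  | nil => exact absurd (List.suffix_nil.1 hz).symm hzw
  | cons i c =>
    have hc : w <:+ c := (List.suffix_cons_iff.1 hz).resolve_left hzw.symm
    rcases houseTree_adj_cons h with ⟨rfl, -⟩ | rfl | rfl | ⟨j, rfl⟩
    · exact hu hc
    · exact hu (hc.trans (List.suffix_cons _ _))
    · exact hu (hc.trans (List.suffix_cons _ _))
    · exact hu (hz.trans (List.suffix_cons _ _))

/-- Every vertex separates its proper descendants from the other vertices. -/
lemma dist_add_dist_le {N : ℕ} {T : SimpleGraph (Vertex N)} (hT : T ≤ boundedHouseTree N)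
    (hconn : T.Connected) {x w y : Vertex N} (hy : w.1 <:+ y.1) (hx : w.1 <:+ x.1 → x = w) :
    T.dist x w + T.dist w y ≤ T.dist x y := by
  classical
  by_cases hyw : y = w
  · subst hyw
    simp
  obtain ⟨p, hp⟩ := hconn.exists_walk_length_eq_dist x y
  have hw : w ∈ p.support := by
    obtain ⟨d, hd, h1, h2⟩ := p.exists_boundary_dart {z | w.1 <:+ z.1 → z = w} hx
      (fun h => hyw (h hy))
    simp only [Set.mem_ofPred_eq, Classical.not_imp] at h1 h2
    have : d.fst = w := Subtype.ext (houseTree_eq_of_adj (hT d.adj).symm h2.1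
      (fun h => h2.2 (Subtype.ext h)) fun h => congrArg Subtype.val (h1 h))
    exact this ▸ p.dart_fst_mem_support_of_mem_darts hd
  rw [← hp, ← p.take_spec hw, Walk.length_append]
  exact add_le_add (dist_le _) (dist_le _)

lemma dist_eq_four_of_isTree {V : Type*} {T : SimpleGraph V} (hT : T.IsTree) {a b c d e : V}
    (hab : T.Adj a b) (hbc : T.Adj b c) (hcd : T.Adj c d) (hde : T.Adj d e)
    (hnodup : [a, b, c, d, e].Nodup) : T.dist a e = 4 := by
  let p : T.Walk a e := .cons hab (.cons hbc (.cons hcd (.cons hde .nil)))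
  have hp : p.IsPath := by
    rw [Walk.isPath_def]
    exact hnodup
  obtain ⟨q, hq, hlen⟩ := hT.1.exists_path_of_dist a e
  have := (hT.2.subsingleton_path a e).elim ⟨p, hp⟩ ⟨q, hq⟩
  rw [← hlen, ← show p = q from congrArg Subtype.val this]
  rfl

/-- The tree `T` preserves all distances between the apex `w` and the walls of its house. -/
def Safe {N : ℕ} (T : SimpleGraph (Vertex N)) (w : List (Fin 4)) : Prop :=
  ∀ (hw : w.length ≤ N) (i : Fin 4) (hi : (i :: w).length ≤ N),
    T.dist ⟨w, hw⟩ ⟨i :: w, hi⟩ ≤ (boundedHouseTree N).dist ⟨w, hw⟩ ⟨i :: w, hi⟩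

/-- Along the descending path from `v` to `y`, the tree `T` loses at least `m`. -/
def Loses {N : ℕ} (T : SimpleGraph (Vertex N)) (v y : List (Fin 4)) (m : ℕ) : Prop :=
  v <:+ y ∧ ∃ (hv : v.length ≤ N) (hy : y.length ≤ N),
    (boundedHouseTree N).dist ⟨v, hv⟩ ⟨y, hy⟩ + m ≤ T.dist ⟨v, hv⟩ ⟨y, hy⟩

/-- A shortest walk here must have exactly one inner vertex, and the only common neighbour available
is `m`. Used to force the walls from roof to floor into a safe tree. -/
lemma adj_of_dist_le_two {N : ℕ} {T : SimpleGraph (Vertex N)} (hT : T ≤ boundedHouseTree N)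
    (hconn : T.Connected) {w m i : Vertex N} (hwi : ¬ houseTree.Adj w.1 i.1) (hne : w ≠ i)
    (hm : ∀ z, houseTree.Adj w.1 z → houseTree.Adj i.1 z → z = m.1) (h : T.dist w i ≤ 2) :
    T.Adj m i := by
  obtain ⟨p, hp⟩ := hconn.exists_walk_length_eq_dist w i
  rw [← hp] at h
  match p, h with
  | .nil, _ => exact absurd rfl hne
  | .cons h1 .nil, _ => exact absurd (hT h1) hwi
  | .cons (v := z) h1 (.cons h2 .nil), _ =>
    have : z = m := Subtype.ext (hm z.1 (hT h1) (hT h2).symm)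
    exact this ▸ h2
  | .cons _ (.cons _ (.cons _ _)), h =>
    simp only [Walk.length_cons] at h
    omega

lemma houseTree_adj_apex {w : List (Fin 4)} {i : Fin 4} (h : houseTree.Adj w (i :: w)) :
    i = 0 ∨ i = 3 := by
  rcases houseTree_adj_cons h.symm with ⟨-, h⟩ | h | h | ⟨j, h⟩
  · exact h
  all_goals exact absurd (congrArg List.length h) (by simp; try omega)

/-- A tree that is safe at `w` has distance four between the two floor vertices of the house. -/
lemma Safe.dist_floor {N : ℕ} {T : SimpleGraph (Vertex N)}
    (hT : CollTree.IsSpanningTree (boundedHouseTree N) T) {w : List (Fin 4)} (h : Safe T w)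
    (hw : ∀ i : Fin 4, (i :: w).length ≤ N) :
    T.dist ⟨1 :: w, hw 1⟩ ⟨2 :: w, hw 2⟩ = 4 := by
  have hw' : w.length ≤ N := by
    have := hw 0
    simp at this
    omega
  have e : ∀ {i j : Fin 4}, houseTree.Adj (i :: w) (j :: w) →
      (boundedHouseTree N).Adj ⟨i :: w, hw i⟩ ⟨j :: w, hw j⟩ := id
  have e0 : (boundedHouseTree N).Adj ⟨w, hw'⟩ ⟨0 :: w, hw 0⟩ := houseTree_adj_left w
  have e3 : (boundedHouseTree N).Adj ⟨w, hw'⟩ ⟨3 :: w, hw 3⟩ := houseTree_adj_right w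
  have e01 := e (houseTree_adj_wall w 0)
  have e32 := (e (houseTree_adj_wall w 2)).symm
  have adj_of : ∀ i, (boundedHouseTree N).Adj ⟨w, hw'⟩ ⟨i :: w, hw i⟩ →
      T.Adj ⟨w, hw'⟩ ⟨i :: w, hw i⟩ := by
    intro i hi
    have h1 := h hw' i (hw i)
    rw [dist_eq_one_iff_adj.2 hi] at h1
    have h2 := hT.2.1.pos_dist_of_ne hi.ne
    exact dist_eq_one_iff_adj.1 (by omega)
  have hlen : ∀ {l : List (Fin 4)}, l ≠ w → ∀ h, (⟨w, hw'⟩ : Vertex N) ≠ ⟨l, h⟩ :=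
    fun h _ h' => h (congrArg Subtype.val h').symm
  have not_apex : ∀ {j k : Fin 4}, houseTree.Adj w (j :: k :: w) → False := by
    intro j k h
    rcases houseTree_adj_cons h.symm with ⟨h, -⟩ | h | h | ⟨j, h⟩ <;>
      exact absurd (congrArg List.length h) (by simp; try omega)
  have t0 := adj_of 0 e0
  have t3 := adj_of 3 e3
  have t01 : T.Adj ⟨0 :: w, hw 0⟩ ⟨1 :: w, hw 1⟩ := by
    refine adj_of_dist_le_two hT.1 hT.2.1 (w := ⟨w, hw'⟩) ?_ (hlen (by simp) _) ?_
      ((h hw' 1 (hw 1)).trans (dist_le (.cons e0 (.cons e01 .nil))))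
    · intro h
      exact absurd (houseTree_adj_apex h) (by decide)
    · intro z h1 h2
      rcases houseTree_adj_cons h2 with ⟨-, h⟩ | rfl | rfl | ⟨j, rfl⟩
      · exact absurd h (by decide)
      · exact absurd (houseTree_adj_apex h1) (by decide)
      · rfl
      · exact (not_apex h1).elim
  have t32 : T.Adj ⟨3 :: w, hw 3⟩ ⟨2 :: w, hw 2⟩ := by
    refine adj_of_dist_le_two hT.1 hT.2.1 (w := ⟨w, hw'⟩) ?_ (hlen (by simp) _) ?_
      ((h hw' 2 (hw 2)).trans (dist_le (.cons e3 (.cons e32 .nil))))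
    · intro h
      exact absurd (houseTree_adj_apex h) (by decide)
    · intro z h1 h2
      rcases houseTree_adj_cons h2 with ⟨-, h⟩ | rfl | rfl | ⟨j, rfl⟩
      · exact absurd h (by decide)
      · rfl
      · exact absurd (houseTree_adj_apex h1) (by decide)
      · exact (not_apex h1).elim
  exact dist_eq_four_of_isTree hT.2 t01.symm t0.symm t3 t32 (by simp)

section Loses

variable {N : ℕ} {T : SimpleGraph (Vertex N)} {v w : List (Fin 4)} {m : ℕ}

lemma Loses.refl (T : SimpleGraph (Vertex N)) (hv : v.length ≤ N) : Loses T v v 0 :=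
  ⟨List.suffix_rfl, hv, hv, by simp⟩

/-- Losses add up along a descending path. -/
lemma Loses.trans (hT : T ≤ boundedHouseTree N) (hconn : T.Connected) {y : List (Fin 4)} {k : ℕ}
    (h : Loses T v w m) (h' : Loses T w y k) : Loses T v y (m + k) := by
  obtain ⟨hvw, hv, hw, h⟩ := h
  obtain ⟨hwy, _, hy, h'⟩ := h'
  refine ⟨hvw.trans hwy, hv, hy, ?_⟩
  have h1 := (boundedHouseTree_connected N).dist_triangle (u := ⟨v, hv⟩) (v := ⟨w, hw⟩) (w := ⟨y, hy⟩)
  have h2 := dist_add_dist_le hT hconn (x := ⟨v, hv⟩) (w := ⟨w, hw⟩) (y := ⟨y, hy⟩) hwy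
    fun h => Subtype.ext (hvw.eq_of_length_le h.length_le)
  omega

lemma Loses.cons (hT : T ≤ boundedHouseTree N) (hconn : T.Connected) (h : Loses T v w m)
    (hw : w.length < N) (i : Fin 4) : Loses T v (i :: w) m :=
  h.trans hT hconn (k := 0)
    ⟨List.suffix_cons _ _, hw.le, hw, (hconn.preconnected _ _).dist_anti hT⟩

lemma Loses.exists_succ (hT : T ≤ boundedHouseTree N) (hconn : T.Connected) (h : Loses T v w m)
    (hs : ¬ Safe T w) : ∃ i, Loses T v (i :: w) (m + 1) := by
  simp only [Safe, not_forall, not_le] at hs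
  obtain ⟨hw, i, hi, hs⟩ := hs
  exact ⟨i, h.trans hT hconn ⟨List.suffix_cons _ _, hw, hi, hs⟩⟩

end Loses

/-! ### The combinatorial core -/

/-- The depth that is needed against `k` spanning trees. -/
def depth : ℕ → ℕ
  | 0 => 1
  -- One level for the child `a₀ :: w`, then three rounds for each of at most `k + 1` indices, each
  -- round descending at most `depth k` levels.
  | k + 1 => 1 + 3 * (k + 1) * depth k

/-- Given finitely many indices, each of which is safe or unsafe at every node of a tree,
there are a node `c` below `w` and a descendant `y` of its child `a₀ :: c` such that every
index is safe at `c` or loses `3` on the way from `a₀ :: c` to `y`. -/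
theorem exists_safe_or_loses {ι α : Type*} (a₀ : α) (N : ℕ) (S : ι → List α → Prop)
    (X : ι → List α → List α → ℕ → Prop)
    (refl : ∀ i v, v.length ≤ N → X i v v 0)
    (cons : ∀ i v w m a, X i v w m → w.length < N → X i v (a :: w) m)
    (succ : ∀ i v w m, X i v w m → w.length < N → ¬ S i w → ∃ a, X i v (a :: w) (m + 1))
    (k : ℕ) (I : Finset ι) (w : List α) (hI : I.card ≤ k) (hN : w.length + depth k ≤ N) :
    ∃ c y, c.length < w.length + depth k ∧ y.length ≤ w.length + depth k ∧ a₀ :: c <:+ y ∧ w <:+ c ∧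
      ∀ i ∈ I, S i c ∨ X i (a₀ :: c) y 3 := by
  classical
  induction k generalizing I w with
  | zero =>
    have : I = ∅ := Finset.card_eq_zero.1 (by omega)
    exact ⟨w, a₀ :: w, by simp [depth], by simp [depth], List.suffix_rfl, List.suffix_rfl,
      by simp [this]⟩
  | succ k ih =>
    have hd : depth (k + 1) = 1 + 3 * (k + 1) * depth k := rfl
    set M := w.length + depth (k + 1) with hM
    -- If some index is safe on all the top `depth k` levels below some `v`, the induction
    -- hypothesis at `v` handles the others. If not, every index is unsafe somewhere within `depth
    -- k` levels below any node that leaves enough room.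
    by_cases hsafe : ∃ i ∈ I, ∃ v : List α, w <:+ v ∧ v.length + depth k ≤ M ∧
        ∀ c, v <:+ c → c.length < v.length + depth k → S i c
    · obtain ⟨i, hi, v, hv', hv, hS⟩ := hsafe
      have hcard := Finset.card_erase_of_mem hi
      obtain ⟨c, y, hc, hy, hcy, hvc, h⟩ := ih (I.erase i) v (by omega) (by omega)
      refine ⟨c, y, by omega, by omega, hcy, hv'.trans hvc, fun j hj => ?_⟩
      by_cases hji : j = i
      · exact .inl (hji ▸ hS c hvc hc)
      · exact h j (Finset.mem_erase.2 ⟨hji, hj⟩)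
    · push Not at hsafe
      have grow : ∀ i v y c m, X i v y m → y <:+ c → c.length ≤ N → X i v c m := by
        intro i v y c m h hyc hc
        induction c with
        | nil => exact List.suffix_nil.1 hyc ▸ h
        | cons a c ihc =>
          rcases List.suffix_cons_iff.1 hyc with rfl | hyc
          · exact h
          · exact cons i v c m a (ihc hyc (by simp at hc; omega)) (by simpa using hc)
      -- Each entry of `L` pays for one round: go down to a node unsafe for that index, then to the
      -- child where it loses 1. The other indices keep their losses.
      have descend : ∀ (L : List ι), (∀ i ∈ L, i ∈ I) → ∀ v : List α, w <:+ v →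
          v.length + L.length * depth k ≤ M → ∃ y, v <:+ y ∧
            y.length ≤ v.length + L.length * depth k ∧ ∀ i, X i v y (L.count i) := by
        intro L hL v hwv hv
        induction L with
        | nil => exact ⟨v, List.suffix_rfl, by simp, fun i => by
            simpa using refl i v (by simp at hv; omega)⟩
        | cons j L ihL =>
          simp only [List.length_cons, Nat.add_one_mul] at hv ⊢
          obtain ⟨y, hvy, hy, hX⟩ := ihL (fun i hi => hL i (List.mem_cons_of_mem _ hi)) (by omega)
          obtain ⟨c, hyc, hc, hs⟩ := hsafe j (hL j List.mem_cons_self) y (hwv.trans hvy) (by omega)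
          have hX' := fun i => grow i v y c _ (hX i) hyc (by omega)
          obtain ⟨a, ha⟩ := succ j v c _ (hX' j) (by omega) hs
          refine ⟨a :: c, (hvy.trans hyc).trans (List.suffix_cons _ _), by simp; omega, fun i => ?_⟩
          by_cases hij : j = i
          · subst hij
            simpa using ha
          · rw [List.count_cons_of_ne hij]
            exact cons i v c _ a (hX' i) (by omega)
      have hmul : 3 * I.card * depth k ≤ 3 * (k + 1) * depth k := by gcongr
      have hlen : (I.toList ++ I.toList ++ I.toList).length = 3 * I.card := by
        simp
        omega
      -- Three copies of every index produce a loss of 3 for each.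
      obtain ⟨y, hvy, hy, hX⟩ := descend (I.toList ++ I.toList ++ I.toList) (by simp) (a₀ :: w)
        (List.suffix_cons _ _) (by rw [hlen, List.length_cons]; omega)
      rw [hlen, List.length_cons] at hy
      refine ⟨w, y, by omega, by omega, hvy, List.suffix_rfl, fun i hi => .inr ?_⟩
      have h1 : I.toList.count i = 1 :=
        List.count_eq_one_of_mem I.nodup_toList (Finset.mem_toList.2 hi)
      simpa [List.count_append, h1] using hX i

theorem boundedHouseTree_not_admitsTreeSpanners (μ : ℕ) :
    ¬ CollTree.AdmitsTreeSpanners (boundedHouseTree (depth μ)) μ 2 := by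
  generalize hN : depth μ = N
  rintro ⟨𝒯, hcard, htree, hspan⟩
  have hle : ∀ T : 𝒯, T.1 ≤ boundedHouseTree N := fun T => (htree T.1 T.2).1
  have hconn : ∀ T : 𝒯, T.1.Connected := fun T => (htree T.1 T.2).2.1
  -- The letter 2 places `y` below one end of the floor edge; the other end, `1 :: c`, is the second
  -- vertex of the bad pair.
  obtain ⟨c, y, hc, hy, hcy, -, h⟩ := exists_safe_or_loses (2 : Fin 4) N (fun T : 𝒯 => Safe T.1)
    (fun T => Loses T.1) (fun T v hv => .refl T.1 hv)
    (fun T v w m a h hw => h.cons (hle T) (hconn T) hw a)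
    (fun T v w m h _ hs => h.exists_succ (hle T) (hconn T) hs)
    μ Finset.univ [] (by simpa using hcard) (by simp [hN])
  simp only [List.length_nil, zero_add, hN] at hc hy
  have hw : ∀ i : Fin 4, (i :: c).length ≤ N := fun _ => hc
  obtain ⟨T, hT, hTd⟩ := hspan ⟨1 :: c, hw 1⟩ ⟨y, hy⟩
  have h1 : (boundedHouseTree N).dist ⟨1 :: c, hw 1⟩ ⟨2 :: c, hw 2⟩ = 1 :=
    dist_eq_one_iff_adj.2 (houseTree_adj_wall c 1)
  have h2 := (boundedHouseTree_connected N).dist_triangle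
    (u := ⟨1 :: c, hw 1⟩) (v := ⟨2 :: c, hw 2⟩) (w := ⟨y, hy⟩)
  have h3 := dist_add_dist_le (hle ⟨T, hT⟩) (hconn ⟨T, hT⟩) (x := ⟨1 :: c, hw 1⟩)
    (w := ⟨2 :: c, hw 2⟩) (y := ⟨y, hy⟩) hcy
    fun h => Subtype.ext (h.eq_of_length_le (by simp)).symm
  have h4 : (boundedHouseTree N).dist ⟨2 :: c, hw 2⟩ ⟨y, hy⟩ ≤ T.dist ⟨2 :: c, hw 2⟩ ⟨y, hy⟩ :=
    ((hconn ⟨T, hT⟩).preconnected _ _).dist_anti (hle ⟨T, hT⟩)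
  have h5 : (boundedHouseTree N).dist ⟨1 :: c, hw 1⟩ ⟨2 :: c, hw 2⟩ ≤
      T.dist ⟨1 :: c, hw 1⟩ ⟨2 :: c, hw 2⟩ :=
    ((hconn ⟨T, hT⟩).preconnected _ _).dist_anti (hle ⟨T, hT⟩)
  dsimp only at h3
  -- A safe tree loses 3 on the floor edge and gains nothing below it; any other loses 3 below it
  -- and gains nothing on the edge.
  rcases h ⟨T, hT⟩ (Finset.mem_univ _) with hs | ⟨_, _, _, hl⟩
  · have := hs.dist_floor (htree T hT) hw
    omega
  · dsimp only at hl
    omega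

end HouseTree

theorem mainTheorem9 :
    ∀ μ : ℕ,
      (∃ (V : Type) (_ : Finite V) (G : SimpleGraph V),
        G.Connected ∧ CollTree.IsWeaklyChordal G ∧ ¬ CollTree.AdmitsTreeSpanners G μ 2) ∧
      (∃ (V : Type) (_ : Finite V) (G : SimpleGraph V),
        G.Connected ∧ CollTree.IsOuterplanar G ∧ ¬ CollTree.AdmitsTreeSpanners G μ 2) := by
  intro μ
  have h := HouseTree.boundedHouseTree_not_admitsTreeSpanners μ
  exact ⟨⟨_, inferInstance, _, HouseTree.boundedHouseTree_connected _,
      HouseTree.boundedHouseTree_isWeaklyChordal _, h⟩,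
    ⟨_, inferInstance, _, HouseTree.boundedHouseTree_connected _,
      HouseTree.boundedHouseTree_isOuterplanar _, h⟩⟩
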